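/- Let $T$ be an infinite tree (a connected graph without cycles, not necessarily locally finite), and give $\mathrm{Aut}\,T$ the permutation topology, in which the pointwise stabilizers of finite sets of vertices form a neighbourhood basis of the identity. A half-tree of $T$ is a component of $T\setminus\{e\}$ for an edge $e$ of $T$ such that both components of $T\setminus\{e\}$ are infinite. An end of $T$ is an equivalence class of rays (one-way infinite paths), where two rays are equivalent if some ray contains infinitely many vertices of each of them. Let $G$ be a closed subgroup of $\mathrm{Aut}\,T$ such that no proper non-empty subtree of $T$ is invariant under $G$ and no end of $T$ is fixed by $G$, and suppose that $G$ has property H: for every half-tree of $T$, its pointwise stabilizer in $G$ is non-trivial. Let $G^{++}$ be the closure of the subgroup generated by the pointwise stabilizers in $G$ of all half-trees of $T$. Then $G^{++}$ is the unique minimal closed normal subgroup of $G$; that is, $G^{++}$ is minimal among the non-trivial closed normal subgroups of $G$, it is the only minimal one, and it is contained in every non-trivial closed normal subgroup of $G$. -/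

import Mathlib

namespace SimpleGraph

variable {V : Type*}

/-- The permutation topology on the automorphism group of a graph: the topology of pointwise
convergence, the vertex set being discrete. -/
instance autTopologicalSpace (T : SimpleGraph V) : TopologicalSpace (T ≃g T) :=
  TopologicalSpace.induced (fun (g : T ≃g T) (v : V) => g v)
    (@Pi.topologicalSpace V (fun _ => V) (fun _ => ⊥))

/-- The defining neighbourhood basis of the permutation topology. -/
theorem aut_hasBasis_nhds (T : SimpleGraph V) (g : T ≃g T) :
    (nhds g).HasBasis (fun F : Set V => F.Finite)
      (fun F => {h : T ≃g T | ∀ v ∈ F, h v = g v}) := by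
  let _ : TopologicalSpace V := ⊥
  have : DiscreteTopology V := ⟨rfl⟩
  have h0 : nhds g = Filter.comap (fun (h : T ≃g T) (v : V) => h v)
      (nhds (fun v : V => g v)) := nhds_induced _ _
  rw [h0, nhds_pi]
  have hb := (Filter.hasBasis_pi (fun v : V => Filter.hasBasis_pure (g v))).comap
    (fun (h : T ≃g T) (v : V) => h v)
  simp only [nhds_discrete]
  refine hb.to_hasBasis ?_ ?_
  · rintro ⟨F, f⟩ ⟨hF, -⟩
    exact ⟨F, hF, fun h hh v hv => hh v hv⟩
  · intro F hF
    exact ⟨(F, fun _ => ()), ⟨hF, fun _ _ => trivial⟩, fun h hh v hv => hh v hv⟩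

instance autIsTopologicalGroup (T : SimpleGraph V) : IsTopologicalGroup (T ≃g T) where
  continuous_mul := by
    rw [continuous_iff_continuousAt]
    rintro ⟨a, b⟩
    rw [ContinuousAt, nhds_prod_eq,
      ((aut_hasBasis_nhds T a).prod (aut_hasBasis_nhds T b)).tendsto_iff
        (aut_hasBasis_nhds T (a * b))]
    intro F hF
    refine ⟨((fun v => b v) '' F, F), ⟨hF.image _, hF⟩, ?_⟩
    rintro ⟨x, y⟩ ⟨hx, hy⟩ v hv
    change x (y v) = a (b v)
    rw [hy v hv]
    exact hx _ ⟨v, hv, rfl⟩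
  continuous_inv := by
    rw [continuous_iff_continuousAt]
    intro a
    rw [ContinuousAt, (aut_hasBasis_nhds T a).tendsto_iff (aut_hasBasis_nhds T a⁻¹)]
    intro F hF
    refine ⟨(fun v => a.symm v) '' F, hF.image _, ?_⟩
    intro x hx v hv
    change x.symm v = a.symm v
    have h1 : x (a.symm v) = a (a.symm v) := hx _ ⟨v, hv, rfl⟩
    rw [RelIso.apply_symm_apply] at h1
    rw [RelIso.symm_apply_eq, h1]

/-- No proper non-empty subtree is invariant under `G` (a tree is connected, hence non-empty). -/
def NoProperInvariantSubtree (T : SimpleGraph V) (G : Subgroup (T ≃g T)) : Prop :=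
  ∀ S : T.Subgraph, S.coe.IsTree →
    (∀ g ∈ G, S.map (RelIso.toRelEmbedding g).toRelHom = S) → S = ⊤

/-- The vertex set of the component containing `u` of the graph obtained by removing the
edge `{u, v}`. -/
def edgeSide (T : SimpleGraph V) (u v : V) : Set V :=
  ((T.deleteEdges {s(u, v)}).connectedComponentMk u).supp

/-- `S` is the vertex set of a half-tree: one of the two components left after removing an edge,
both components being infinite. -/
def IsHalfTree (T : SimpleGraph V) (S : Set V) : Prop :=
  ∃ u v : V, T.Adj u v ∧ (T.edgeSide u v).Infinite ∧ (T.edgeSide v u).Infinite ∧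
    S = T.edgeSide u v

/-- A ray: a sequence of distinct vertices, consecutive ones being adjacent. -/
structure Ray (T : SimpleGraph V) where
  vert : ℕ → V
  injective : Function.Injective vert
  adj : ∀ i, T.Adj (vert i) (vert (i + 1))

/-- Two rays are equivalent if some ray contains infinitely many vertices of each of them. -/
def Ray.Equivalent {T : SimpleGraph V} (r s : T.Ray) : Prop :=
  ∃ t : T.Ray, (Set.range t.vert ∩ Set.range r.vert).Infinite ∧
    (Set.range t.vert ∩ Set.range s.vert).Infinite

/-- The ends of a graph: classes of equivalent rays. -/
def RayEnd (T : SimpleGraph V) : Type _ := Quot (Ray.Equivalent (T := T))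

/-- The image of a ray under an automorphism. -/
def Ray.map {T : SimpleGraph V} (g : T ≃g T) (r : T.Ray) : T.Ray where
  vert i := g (r.vert i)
  injective := g.injective.comp r.injective
  adj i := g.map_adj_iff.2 (r.adj i)

theorem Ray.Equivalent.map {T : SimpleGraph V} (g : T ≃g T) {r s : T.Ray}
    (h : r.Equivalent s) : (r.map g).Equivalent (s.map g) := by
  obtain ⟨t, h1, h2⟩ := h
  have key : ∀ q : T.Ray, Set.range (q.map g).vert = g '' Set.range q.vert := fun q =>
    Set.range_comp g q.vert
  refine ⟨t.map g, ?_, ?_⟩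
  · rw [key, key, ← Set.image_inter g.injective]
    exact h1.image g.injective.injOn
  · rw [key, key, ← Set.image_inter g.injective]
    exact h2.image g.injective.injOn

/-- The image of an end under an automorphism. -/
def RayEnd.map {T : SimpleGraph V} (g : T ≃g T) : T.RayEnd → T.RayEnd :=
  Quot.map (Ray.map g) (fun _ _ h => h.map g)

/-- No end is fixed by all of `G`. -/
def FixesNoEnd (T : SimpleGraph V) (G : Subgroup (T ≃g T)) : Prop :=
  ¬ ∃ ε : T.RayEnd, ∀ g ∈ G, ε.map g = ε

/-- Property H: the pointwise stabilizer of every half-tree is non-trivial. -/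
def PropertyH (T : SimpleGraph V) (G : Subgroup (T ≃g T)) : Prop :=
  ∀ S : Set V, T.IsHalfTree S → fixingSubgroup G S ≠ ⊥

/-- `G⁺⁺`: the closure of the subgroup generated by the pointwise stabilizers of half-trees. -/
def plusPlus (T : SimpleGraph V) (G : Subgroup (T ≃g T)) : Subgroup G :=
  (⨆ (S : Set V) (_ : T.IsHalfTree S), fixingSubgroup G S).topologicalClosure

/-- Non-trivial closed normal subgroups of a topological group. -/
def IsNontrivialClosedNormal {Γ : Type*} [Group Γ] [TopologicalSpace Γ]
    (N : Subgroup Γ) : Prop :=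
  N ≠ ⊥ ∧ IsClosed (N : Set Γ) ∧ N.Normal

end SimpleGraph

namespace SimpleGraph

open scoped Pointwise

variable {V : Type*} {T : SimpleGraph V}

/-! ### Sides of an edge and distances in a tree -/

/-! Let `N` be a non-trivial closed normal subgroup; the core is that `N` contains the pointwise
stabilizer of every half-tree.

No proper subtree is `N`-invariant (`IsGeodesicallyConvex.eq_univ_of_normal`). The vertices fixed by
`N` span a `G`-invariant subtree, so there are none; hence any two `N`-invariant subtrees meet. By
normality `G` permutes these subtrees, so their intersection is `G`-invariant: if empty it would
yield a fixed end, so it is all of `T`.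

Hence for each edge `N` contains a translation carrying a given side properly into itself
(`IsTree.exists_smul_edgeSide_ssubset`), and its powers move any finite set `F` into that side `S`.
If `f` fixes `S` pointwise and `n ∈ N` moves `F` into `S`, the commutator `f n⁻¹ f⁻¹ n` lies in `N`
and agrees with `f` on `F`; as `N` is closed, `f ∈ N`.

Thus `G⁺⁺ ≤ N`. Property H makes `G⁺⁺` itself non-trivial. Subtrees are handled as geodesically
convex vertex sets, sides of edges through distances. -/

theorem IsTree.mem_edgeSide_iff (hT : T.IsTree) {u v : V} (huv : T.Adj u v) (w : V) :
    w ∈ T.edgeSide u v ↔ T.dist w v = T.dist w u + 1 := by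
  classical
  have key : ∀ {a b : V}, T.Adj a b → T.dist w b = T.dist w a + 1 →
      (T.deleteEdges {s(a, b)}).Reachable w a := by
    intro a b hab h
    obtain ⟨p, hp⟩ := hT.connected.exists_walk_length_eq_dist w a
    -- A geodesic from `w` to `a` through the edge would visit `b`, making `b` no farther from `w`
    -- than `a`.
    refine (p.toDeleteEdge s(a, b) fun hmem => ?_).reachable
    have hb := p.snd_mem_support_of_mem_edges hmem
    have h1 := dist_le (p.takeUntil b hb)
    have h2 := p.length_takeUntil_le_length hb
    omega
  have hmem : w ∈ T.edgeSide u v ↔ (T.deleteEdges {s(u, v)}).Reachable w u := by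
    simp [edgeSide, ConnectedComponent.mem_supp_iff, ConnectedComponent.eq]
  rw [hmem]
  refine ⟨fun h => ?_, key huv⟩
  rcases hT.dist_eq_dist_add_one_of_adj w huv with h' | h'
  · have h2 := key huv.symm h'
    rw [Sym2.eq_swap] at h2
    exact absurd (h.symm.trans h2)
      (isBridge_iff.1 (isAcyclic_iff_forall_adj_isBridge.1 hT.isAcyclic huv))
  · exact h'

theorem IsTree.compl_edgeSide (hT : T.IsTree) {u v : V} (huv : T.Adj u v) :
    (T.edgeSide u v)ᶜ = T.edgeSide v u := by
  ext w
  rw [Set.mem_compl_iff, hT.mem_edgeSide_iff huv, hT.mem_edgeSide_iff huv.symm]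
  rcases hT.dist_eq_dist_add_one_of_adj w huv with h | h <;> omega

theorem IsTree.notMem_edgeSide_iff (hT : T.IsTree) {u v : V} (huv : T.Adj u v) {w : V} :
    w ∉ T.edgeSide u v ↔ w ∈ T.edgeSide v u := by
  rw [← hT.compl_edgeSide huv, Set.mem_compl_iff]

theorem left_mem_edgeSide (T : SimpleGraph V) (u v : V) : u ∈ T.edgeSide u v := by
  simp [edgeSide]

theorem IsTree.right_notMem_edgeSide (hT : T.IsTree) {u v : V} (huv : T.Adj u v) :
    v ∉ T.edgeSide u v :=
  (hT.notMem_edgeSide_iff huv).2 (T.left_mem_edgeSide v u)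

/-- A geodesic joining the two sides of an edge crosses that edge. -/
theorem IsTree.dist_of_mem_edgeSide (hT : T.IsTree) {u v a b : V} (huv : T.Adj u v)
    (ha : a ∈ T.edgeSide u v) (hb : b ∈ T.edgeSide v u) :
    T.dist a b = T.dist a u + 1 + T.dist v b := by
  classical
  obtain ⟨p, hp⟩ := hT.connected.exists_walk_length_eq_dist a b
  have hmem : s(u, v) ∈ p.edges := by
    by_contra hmem
    have hab := (p.toDeleteEdge _ hmem).reachable
    refine (hT.notMem_edgeSide_iff huv).2 hb ?_
    simp only [edgeSide, ConnectedComponent.mem_supp_iff, ConnectedComponent.eq] at ha ⊢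
    exact hab.symm.trans ha
  have hu := p.fst_mem_support_of_mem_edges hmem
  have h1 := dist_le (p.takeUntil u hu)
  have h2 := dist_le (p.dropUntil u hu)
  have h3 := congrArg Walk.length (p.take_spec hu)
  rw [Walk.length_append] at h3
  have h4 := hT.connected.dist_triangle (u := a) (v := u) (w := b)
  have h5 := (hT.mem_edgeSide_iff huv.symm b).1 hb
  rw [dist_comm (u := b), dist_comm (u := b)] at h5
  omega

theorem Connected.exists_adj_dist (hT : T.Connected) {a b : V} (hab : a ≠ b) :
    ∃ c, T.Adj a c ∧ T.dist a b = T.dist c b + 1 := by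
  obtain ⟨p, hp⟩ := hT.exists_walk_length_eq_dist a b
  cases p with
  | nil => exact absurd rfl hab
  | @cons _ c _ h q =>
    refine ⟨c, h, ?_⟩
    have h1 := dist_le q
    have h2 := hT.dist_triangle (u := a) (v := c) (w := b)
    rw [dist_eq_one_iff_adj.2 h] at h2
    rw [Walk.length_cons] at hp
    omega

/-- In a tree the neighbour of `a` in the direction of `b` is unique. -/
theorem IsTree.eq_of_dist_lt (hT : T.IsTree) {a b c c' : V} (hc : T.Adj a c) (hc' : T.Adj a c')
    (h : T.dist c b < T.dist a b) (h' : T.dist c' b < T.dist a b) : c = c' := by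
  by_contra hne
  -- The vertex `y'` lies on the side of `a`, so its geodesic to `b` crosses the edge from `a` to
  -- `y`. By symmetry each of `c`, `c'` would be nearer to `b` than the other.
  have key : ∀ {y y' : V}, y ≠ y' → T.Adj a y → T.Adj a y' → T.dist y b < T.dist a b →
      T.dist y b < T.dist y' b := by
    intro y y' hne hy hy' hlt
    have hb : b ∈ T.edgeSide y a := by
      rw [hT.mem_edgeSide_iff hy.symm, dist_comm (u := b), dist_comm (u := b)]
      rcases hT.dist_eq_dist_add_one_of_adj b hy with e | e <;>
        rw [dist_comm (u := b), dist_comm (u := b)] at e <;> omega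
    have hy'' : y' ∈ T.edgeSide a y := by
      rw [hT.mem_edgeSide_iff hy, dist_eq_one_iff_adj.2 hy'.symm]
      have hpos := hT.connected.pos_dist_of_ne hne.symm
      rcases hT.dist_eq_dist_add_one_of_adj y' hy with e | e <;>
        rw [dist_eq_one_iff_adj.2 hy'.symm] at e <;> omega
    have := hT.dist_of_mem_edgeSide hy hy'' hb
    omega
  have h2 := key (Ne.symm hne) hc' hc h'
  have h1 := key hne hc hc' h
  exact lt_asymm h1 h2

/-- A point of a geodesic in a tree is determined by its distance to the origin. -/
theorem IsTree.eq_of_dist_add_dist (hT : T.IsTree) {a b c c' : V}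
    (h : T.dist a c + T.dist c b = T.dist a b) (h' : T.dist a c' + T.dist c' b = T.dist a b)
    (hcc' : T.dist a c = T.dist a c') : c = c' := by
  obtain ⟨k, hk⟩ : ∃ k, T.dist a c = k := ⟨_, rfl⟩
  induction k generalizing a with
  | zero =>
    exact (hT.connected.dist_eq_zero_iff.1 hk).symm.trans
      (hT.connected.dist_eq_zero_iff.1 (hcc'.symm.trans hk))
  | succ k ih =>
    have step : ∀ {y : V}, T.dist a y + T.dist y b = T.dist a b → T.dist a y = k + 1 →
        ∃ x, T.Adj a x ∧ T.dist x y = k ∧ T.dist a b = T.dist x b + 1 := by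
      intro y hy hk
      obtain ⟨x, hx, hd⟩ := hT.connected.exists_adj_dist (a := a) (b := y) (by
        rintro rfl
        simp at hk)
      have h1 := hT.connected.dist_triangle (u := x) (v := y) (w := b)
      have h2 := hT.connected.dist_triangle (u := a) (v := x) (w := b)
      rw [dist_eq_one_iff_adj.2 hx] at h2
      exact ⟨x, hx, by omega, by omega⟩
    obtain ⟨x, hx, hxk, hxb⟩ := step h hk
    obtain ⟨x', hx', hxk', hxb'⟩ := step h' (hcc' ▸ hk)
    obtain rfl := hT.eq_of_dist_lt (b := b) hx hx' (by omega) (by omega)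
    exact ih (by omega) (by omega) (by omega) hxk

/-! ### Convex sets of vertices -/

/-- A set of vertices that contains all geodesics between its points. -/
def IsGeodesicallyConvex (T : SimpleGraph V) (X : Set V) : Prop :=
  ∀ ⦃a⦄, a ∈ X → ∀ ⦃b⦄, b ∈ X → ∀ c, T.dist a c + T.dist c b = T.dist a b → c ∈ X

theorem IsGeodesicallyConvex.inter {X Y : Set V} (hX : T.IsGeodesicallyConvex X)
    (hY : T.IsGeodesicallyConvex Y) : T.IsGeodesicallyConvex (X ∩ Y) :=
  fun _ ha _ hb c h => ⟨hX ha.1 hb.1 c h, hY ha.2 hb.2 c h⟩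

theorem IsGeodesicallyConvex.sInter {F : Set (Set V)}
    (hF : ∀ X ∈ F, T.IsGeodesicallyConvex X) : T.IsGeodesicallyConvex (⋂₀ F) :=
  fun _ ha _ hb c h X hX => hF X hX (ha X hX) (hb X hX) c h

theorem IsTree.isGeodesicallyConvex_edgeSide (hT : T.IsTree) {u v : V} (huv : T.Adj u v) :
    T.IsGeodesicallyConvex (T.edgeSide u v) := by
  intro a ha b hb c h
  by_contra hc
  rw [hT.notMem_edgeSide_iff huv] at hc
  have h1 := hT.dist_of_mem_edgeSide huv ha hc
  have h2 := hT.dist_of_mem_edgeSide huv hb hc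
  have h3 := hT.connected.dist_triangle (u := a) (v := u) (w := b)
  rw [dist_comm (u := b)] at h2
  rw [dist_comm (u := b)] at h2
  omega

theorem Connected.isGeodesicallyConvex_pair (hT : T.Connected) {u v : V} (huv : T.Adj u v) :
    T.IsGeodesicallyConvex {u, v} := by
  have h0 : ∀ {x y : V}, T.dist x y = 0 → x = y := hT.dist_eq_zero_iff.1
  have huv1 := dist_eq_one_iff_adj.2 huv
  have huv2 := dist_eq_one_iff_adj.2 huv.symm
  rintro a (rfl | rfl) b (rfl | rfl) c h
  · rw [dist_self] at h
    exact Or.inl (h0 (by omega)).symm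
  · rcases Nat.eq_zero_or_pos (T.dist a c) with h1 | h1
    · exact Or.inl (h0 h1).symm
    · exact Or.inr (h0 (by omega))
  · rcases Nat.eq_zero_or_pos (T.dist a c) with h1 | h1
    · exact Or.inr (h0 h1).symm
    · exact Or.inl (h0 (by omega))
  · rw [dist_self] at h
    exact Or.inr (h0 (by omega)).symm

/-- A geodesic in `X` crossing the edge would put both `u` and `v` in `X`. -/
theorem IsGeodesicallyConvex.subset_edgeSide (hT : T.IsTree) {X : Set V}
    (hX : T.IsGeodesicallyConvex X) {u v b : V} (huv : T.Adj u v) (hv : v ∉ X ∨ u ∉ X)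
    (hb : b ∈ X) (hbu : b ∈ T.edgeSide u v) : X ⊆ T.edgeSide u v := by
  intro a ha
  by_contra hav
  rw [hT.notMem_edgeSide_iff huv] at hav
  have h1 := hT.dist_of_mem_edgeSide huv hbu hav
  have h2 := (hT.mem_edgeSide_iff huv b).1 hbu
  have h3 := (hT.mem_edgeSide_iff huv.symm a).1 hav
  rw [dist_comm (u := a), dist_comm (u := a)] at h3
  rcases hv with hv | hu
  · exact hv (hX hb ha v (by omega))
  · exact hu (hX hb ha u (by omega))

theorem IsGeodesicallyConvex.exists_adj_subset_edgeSide (hT : T.IsTree) {X : Set V}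
    (hX : T.IsGeodesicallyConvex X) (hne : X.Nonempty) {x : V} (hx : x ∉ X) :
    ∃ y, T.Adj x y ∧ X ⊆ T.edgeSide y x := by
  obtain ⟨b, hb⟩ := hne
  obtain ⟨y, hy, hd⟩ := hT.connected.exists_adj_dist (a := x) (b := b) (by
    rintro rfl
    exact hx hb)
  refine ⟨y, hy, hX.subset_edgeSide hT hy.symm (Or.inl hx) hb ?_⟩
  rw [hT.mem_edgeSide_iff hy.symm, dist_comm, hd, dist_comm]

theorem IsTree.eq_of_mem_edgeSide (hT : T.IsTree) {x y y' b : V} (hy : T.Adj x y)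
    (hy' : T.Adj x y') (hb : b ∈ T.edgeSide y x) (hb' : b ∈ T.edgeSide y' x) : y = y' := by
  rw [hT.mem_edgeSide_iff hy.symm, dist_comm, dist_comm (u := b)] at hb
  rw [hT.mem_edgeSide_iff hy'.symm, dist_comm, dist_comm (u := b)] at hb'
  exact hT.eq_of_dist_lt (b := b) hy hy' (by omega) (by omega)

/-- The point of a convex set nearest to a disjoint convex set. -/
theorem IsGeodesicallyConvex.existsUnique_nearest (hT : T.IsTree) {X Y : Set V}
    (hX : T.IsGeodesicallyConvex X) (hY : T.IsGeodesicallyConvex Y) (hXn : X.Nonempty)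
    (hYn : Y.Nonempty) (hXY : Disjoint X Y) :
    ∃! x, x ∈ X ∧ ∃ y, T.Adj x y ∧ X ⊆ T.edgeSide x y ∧ Y ⊆ T.edgeSide y x := by
  obtain ⟨b, hb⟩ := hYn
  refine existsUnique_of_exists_of_unique ?_ ?_
  · obtain ⟨x, hx, hmin⟩ := exists_minimalFor_of_wellFoundedLT (· ∈ X) (fun x => T.dist x b) hXn
    have hxY : x ∉ Y := Set.disjoint_left.1 hXY hx
    obtain ⟨y, hy, hYs⟩ := hY.exists_adj_subset_edgeSide hT ⟨b, hb⟩ hxY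
    have hyb := (hT.mem_edgeSide_iff hy.symm b).1 (hYs hb)
    rw [dist_comm, dist_comm (u := b)] at hyb
    have hyX : y ∉ X := fun hyX => by
      have := hmin hyX (by simp only []; omega)
      simp only [] at this
      omega
    exact ⟨x, hx, y, hy, hX.subset_edgeSide hT hy (Or.inl hyX) hx (T.left_mem_edgeSide x y), hYs⟩
  -- Comparing geodesics to `b`, `x` lies between `x'` and `b`, and `x'` between `x` and `b`.
  · rintro x x' ⟨hx, y, hy, hXs, hYs⟩ ⟨hx', y', hy', hXs', hYs'⟩
    have h1 := hT.dist_of_mem_edgeSide hy (hXs hx') (hYs hb)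
    have h2 := hT.dist_of_mem_edgeSide hy (hXs hx) (hYs hb)
    have h3 := hT.dist_of_mem_edgeSide hy' (hXs' hx) (hYs' hb)
    have h4 := hT.dist_of_mem_edgeSide hy' (hXs' hx') (hYs' hb)
    rw [dist_self] at h2 h4
    exact hT.connected.dist_eq_zero_iff.1 (by omega)

theorem IsGeodesicallyConvex.isTree_induce (hT : T.IsTree) {X : Set V}
    (hX : T.IsGeodesicallyConvex X) (hne : X.Nonempty) :
    ((⊤ : T.Subgraph).induce X).coe.IsTree := by
  have hreach : ∀ k, ∀ a b : ((⊤ : T.Subgraph).induce X).verts, T.dist a b = k →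
      ((⊤ : T.Subgraph).induce X).coe.Reachable a b := by
    intro k
    induction k with
    | zero =>
      intro a b h
      rw [Subtype.ext (hT.connected.dist_eq_zero_iff.1 h)]
    | succ k ih =>
      intro a b h
      obtain ⟨c, hc, hd⟩ := hT.connected.exists_adj_dist (a := (a : V)) (b := b) (fun e => by
        rw [e] at h
        simp at h)
      have hcX : c ∈ X := hX a.2 b.2 c (by rw [dist_eq_one_iff_adj.2 hc]; omega)
      refine Reachable.trans (Adj.reachable (v := ⟨c, hcX⟩) ?_)
        (ih ⟨c, hcX⟩ b (by simp only []; omega))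
      exact ⟨a.2, hcX, hc⟩
  refine ⟨?_, hT.isAcyclic.subgraph _⟩
  obtain ⟨x, hx⟩ := hne
  have : Nonempty ((⊤ : T.Subgraph).induce X).verts := ⟨⟨x, hx⟩⟩
  exact Connected.mk fun a b => hreach _ a b rfl

/-! ### Sequences without backtracking -/

/-- If the distance to `r i` dropped at some step, the next and the previous vertex would both be
the unique neighbour towards `r i`, which is backtracking. -/
theorem IsTree.dist_of_forall_ne (hT : T.IsTree) {r : ℕ → V} (hadj : ∀ i, T.Adj (r i) (r (i + 1)))
    (hne : ∀ i, r (i + 2) ≠ r i) (i k : ℕ) : T.dist (r i) (r (i + k)) = k := by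
  suffices h : T.dist (r i) (r (i + k)) = k ∧ T.dist (r i) (r (i + (k + 1))) = k + 1 from h.1
  induction k with
  | zero => exact ⟨by simp, by simpa using hadj i⟩
  | succ k ih =>
    refine ⟨ih.2, ?_⟩
    rcases hT.dist_eq_dist_add_one_of_adj (r i) (hadj (i + (k + 1))) with h | h
    · refine absurd (hT.eq_of_dist_lt (a := r (i + (k + 1))) (b := r i) (hadj _)
        (hadj (i + k)).symm ?_ ?_) (hne (i + k))
      · rw [dist_comm, dist_comm (v := r i)]
        omega
      · rw [dist_comm, dist_comm (v := r i)]
        omega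
    · rw [ih.2] at h
      exact h

theorem IsTree.injective_of_forall_ne (hT : T.IsTree) {r : ℕ → V}
    (hadj : ∀ i, T.Adj (r i) (r (i + 1))) (hne : ∀ i, r (i + 2) ≠ r i) :
    Function.Injective r := by
  intro i j hij
  wlog hle : i ≤ j generalizing i j
  · exact (this hij.symm (by omega)).symm
  obtain ⟨k, rfl⟩ := Nat.exists_eq_add_of_le hle
  have := hT.dist_of_forall_ne hadj hne i k
  rw [← hij, dist_self] at this
  omega

/-! ### The action of a group of automorphisms -/

variable {G : Subgroup (T ≃g T)}

theorem Connected.dist_smul (hT : T.Connected) (g : G) (x y : V) :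
    T.dist (g • x) (g • y) = T.dist x y := by
  have key : ∀ (h : G) (a b : V), T.dist (h • a) (h • b) ≤ T.dist a b := by
    intro h a b
    obtain ⟨p, hp⟩ := hT.exists_walk_length_eq_dist a b
    rw [← hp, ← Walk.length_map (h : T ≃g T).toHom p]
    exact dist_le _
  refine le_antisymm (key g x y) ?_
  simpa using key g⁻¹ (g • x) (g • y)

theorem adj_smul_iff (g : G) {x y : V} : T.Adj (g • x) (g • y) ↔ T.Adj x y :=
  (g : T ≃g T).map_adj_iff

theorem IsTree.smul_mem_edgeSide_iff (hT : T.IsTree) (g : G) {u v : V} (huv : T.Adj u v)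
    {w : V} : g • w ∈ T.edgeSide (g • u) (g • v) ↔ w ∈ T.edgeSide u v := by
  rw [hT.mem_edgeSide_iff huv, hT.mem_edgeSide_iff ((adj_smul_iff g).2 huv),
    hT.connected.dist_smul, hT.connected.dist_smul]

theorem IsGeodesicallyConvex.smul_preimage (hT : T.Connected) {X : Set V}
    (hX : T.IsGeodesicallyConvex X) (g : G) : T.IsGeodesicallyConvex {x | g • x ∈ X} := by
  intro a ha b hb c h
  refine hX ha hb (g • c) ?_
  rwa [hT.dist_smul, hT.dist_smul, hT.dist_smul]

theorem IsGeodesicallyConvex.eq_univ (hT : T.IsTree) (hsub : T.NoProperInvariantSubtree G)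
    {X : Set V} (hX : T.IsGeodesicallyConvex X) (hne : X.Nonempty)
    (hinv : ∀ g : G, ∀ x ∈ X, g • x ∈ X) : X = Set.univ := by
  have key := hsub ((⊤ : T.Subgraph).induce X) (hX.isTree_induce hT hne) (by
    intro g hg
    have himage : ∀ x, g x ∈ X ↔ x ∈ X := by
      intro x
      refine ⟨fun h => ?_, hinv ⟨g, hg⟩ x⟩
      have := hinv (⟨g, hg⟩⁻¹ : G) _ h
      rwa [show (g x : V) = (⟨g, hg⟩ : G) • x from rfl, inv_smul_smul] at this
    ext a b
    · obtain ⟨a, rfl⟩ := g.surjective a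
      constructor
      · rintro ⟨x, hx, hxa⟩
        exact hxa ▸ (himage x).2 hx
      · intro ha
        exact ⟨a, (himage a).1 ha, rfl⟩
    · constructor
      · rintro ⟨x, y, ⟨hx, hy, hxy⟩, rfl, rfl⟩
        exact ⟨(himage x).2 hx, (himage y).2 hy, g.map_adj_iff.2 hxy⟩
      · obtain ⟨a, rfl⟩ := g.surjective a
        obtain ⟨b, rfl⟩ := g.surjective b
        rintro ⟨ha, hb, hab⟩
        exact ⟨a, b, ⟨(himage a).1 ha, (himage b).1 hb, g.map_adj_iff.1 hab⟩, rfl, rfl⟩)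
  have := congrArg Subgraph.verts key
  simpa using this

/-- A non-trivial normal subgroup has no fixed vertex. -/
theorem IsTree.exists_smul_ne (hT : T.IsTree) (hsub : T.NoProperInvariantSubtree G)
    {N : Subgroup G} (hN : N.Normal) (hbot : N ≠ ⊥) (x : V) : ∃ n ∈ N, n • x ≠ x := by
  by_contra! hfix
  -- A geodesic with fixed endpoints is fixed pointwise; normality will make this set `G`-invariant.
  have hX : T.IsGeodesicallyConvex {y : V | ∀ n ∈ N, n • y = y} := by
    intro a ha b hb c h n hn
    refine hT.eq_of_dist_add_dist (a := a) (b := b) ?_ h ?_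
    · have h1 := hT.connected.dist_smul n a c
      have h2 := hT.connected.dist_smul n c b
      rw [ha n hn] at h1
      rw [hb n hn] at h2
      omega
    · have h1 := hT.connected.dist_smul n a c
      rwa [ha n hn] at h1
  have huniv := hX.eq_univ hT hsub ⟨x, hfix⟩ (by
    intro g y hy n hn
    have := hy _ (hN.conj_mem' n hn g)
    rwa [mul_smul, mul_smul, inv_smul_eq_iff] at this)
  refine hbot ((Subgroup.eq_bot_iff_forall _).2 fun n hn => Subtype.ext (RelIso.ext fun y => ?_))
  have : y ∈ {y : V | ∀ n ∈ N, n • y = y} := huniv ▸ Set.mem_univ y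
  exact this n hn

/-- Otherwise the unique vertex of `X` nearest to `Y` would be fixed by `N`. -/
theorem IsGeodesicallyConvex.inter_nonempty (hT : T.IsTree)
    {N : Subgroup G} (hfix : ∀ x : V, ∃ n ∈ N, n • x ≠ x) {X Y : Set V}
    (hX : T.IsGeodesicallyConvex X) (hY : T.IsGeodesicallyConvex Y) (hXn : X.Nonempty)
    (hYn : Y.Nonempty) (hXi : ∀ n ∈ N, ∀ x ∈ X, n • x ∈ X) (hYi : ∀ n ∈ N, ∀ x ∈ Y, n • x ∈ Y) :
    (X ∩ Y).Nonempty := by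
  by_contra hempty
  obtain ⟨x, ⟨hx, y, hy, hXs, hYs⟩, huniq⟩ := hX.existsUnique_nearest hT hY hXn hYn
    (Set.disjoint_iff_inter_eq_empty.2 (Set.not_nonempty_iff_eq_empty.1 hempty))
  obtain ⟨n, hn, hne⟩ := hfix x
  refine hne (huniq _ ⟨hXi n hn x hx, n • y, (adj_smul_iff n).2 hy, ?_, ?_⟩)
  · intro a ha
    rw [← smul_inv_smul n a, hT.smul_mem_edgeSide_iff n hy]
    exact hXs (hXi _ (N.inv_mem hn) a ha)
  · intro a ha
    rw [← smul_inv_smul n a, hT.smul_mem_edgeSide_iff n hy.symm]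
    exact hYs (hYi _ (N.inv_mem hn) a ha)

/-- An invariant family of subtrees, closed under intersections, that has no common vertex
singles out a fixed end. -/
theorem IsTree.sInter_nonempty (hT : T.IsTree) (hend : T.FixesNoEnd G) {F : Set (Set V)}
    (hconv : ∀ X ∈ F, T.IsGeodesicallyConvex X) (hne : ∀ X ∈ F, X.Nonempty)
    (hinter : ∀ X ∈ F, ∀ Y ∈ F, X ∩ Y ∈ F)
    (hinv : ∀ g : G, ∀ X ∈ F, {x | g • x ∈ X} ∈ F) : (⋂₀ F).Nonempty := by
  by_contra hempty
  have hmiss : ∀ x, ∃ X ∈ F, x ∉ X := by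
    intro x
    by_contra! h
    exact hempty ⟨x, h⟩
  have hex : ∀ x, ∃ y, T.Adj x y ∧ ∃ X ∈ F, X ⊆ T.edgeSide y x := by
    intro x
    obtain ⟨X, hX, hx⟩ := hmiss x
    obtain ⟨y, hy, hs⟩ := (hconv X hX).exists_adj_subset_edgeSide hT (hne X hX) hx
    exact ⟨y, hy, X, hX, hs⟩
  -- `next x` is the neighbour of `x` towards the missing intersection. It is unique because members
  -- of `F` meet pairwise.
  choose next hadj hnext using hex
  have huniq : ∀ {x y : V}, T.Adj x y → (∃ X ∈ F, X ⊆ T.edgeSide y x) → next x = y := by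
    rintro x y hy ⟨X, hX, hs⟩
    obtain ⟨Y, hY, hs'⟩ := hnext x
    obtain ⟨b, hbX, hbY⟩ := hne _ (hinter X hX Y hY)
    exact hT.eq_of_mem_edgeSide (hadj x) hy (hs' hbY) (hs hbX)
  have hback : ∀ x, next (next x) ≠ x := by
    intro x h
    obtain ⟨X, hX, hs⟩ := hnext x
    obtain ⟨Y, hY, hs'⟩ := hnext (next x)
    rw [h] at hs'
    obtain ⟨b, hbX, hbY⟩ := hne _ (hinter X hX Y hY)
    exact (hT.notMem_edgeSide_iff (hadj x)).2 (hs hbX) (hs' hbY)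
  -- Every edge is oriented by `next`, so the forward orbits of adjacent vertices merge; this makes
  -- all the rays below equivalent.
  have hor : ∀ {x y : V}, T.Adj x y → next x = y ∨ next y = x := by
    intro x y hxy
    obtain ⟨X, hX, hx⟩ := hmiss x
    obtain ⟨b, hb⟩ := hne X hX
    by_cases hby : b ∈ T.edgeSide y x
    · exact Or.inl (huniq hxy ⟨X, hX,
        (hconv X hX).subset_edgeSide hT hxy.symm (Or.inl hx) hb hby⟩)
    · rw [hT.notMem_edgeSide_iff hxy.symm] at hby
      exact Or.inr (huniq hxy.symm ⟨X, hX,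
        (hconv X hX).subset_edgeSide hT hxy (Or.inr hx) hb hby⟩)
  have hequiv : ∀ (g : G) (x : V), next (g • x) = g • next x := by
    intro g x
    refine huniq ((adj_smul_iff g).2 (hadj x)) ?_
    obtain ⟨X, hX, hs⟩ := hnext x
    refine ⟨_, hinv g⁻¹ X hX, fun a ha => ?_⟩
    rw [← smul_inv_smul g a, hT.smul_mem_edgeSide_iff g (hadj x).symm]
    exact hs ha
  have hiter : ∀ x i, next^[i + 1] x = next (next^[i] x) := fun x i =>
    Function.iterate_succ_apply' next i x
  let ray : V → T.Ray := fun x =>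
    { vert := fun i => next^[i] x
      injective := hT.injective_of_forall_ne
        (fun i => by rw [hiter]; exact hadj _)
        (fun i => by rw [hiter, hiter]; exact hback _)
      adj := fun i => by rw [hiter]; exact hadj _ }
  have hmeet : ∀ {x y : V}, T.Reachable x y → ∃ m n, next^[m] x = next^[n] y := by
    rintro x y ⟨p⟩
    induction p with
    | nil => exact ⟨0, 0, rfl⟩
    | @cons x z y h q ih =>
      obtain ⟨m, n, hmn⟩ := ih
      rcases hor h with h | h
      · exact ⟨m + 1, n, by rw [Function.iterate_succ_apply, h, hmn]⟩
      · refine ⟨m, n + 1, ?_⟩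
        rw [hiter, ← hmn, ← hiter, Function.iterate_succ_apply, h]
  have hsubset : ∀ x m, Set.range (ray (next^[m] x)).vert ⊆ Set.range (ray x).vert := by
    rintro x m _ ⟨i, rfl⟩
    exact ⟨i + m, Function.iterate_add_apply next i m x⟩
  have heq : ∀ x y, (ray x).Equivalent (ray y) := by
    intro x y
    obtain ⟨m, n, hmn⟩ := hmeet (hT.connected x y)
    refine ⟨ray (next^[m] x), ?_, ?_⟩
    · rw [Set.inter_eq_left.2 (hsubset x m)]
      exact Set.infinite_range_of_injective (ray _).injective
    · rw [Set.inter_eq_left.2 (hmn ▸ hsubset y n)]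
      exact Set.infinite_range_of_injective (ray _).injective
  obtain ⟨x⟩ := hT.connected.nonempty
  refine hend ⟨Quot.mk _ (ray x), fun g hg => ?_⟩
  have hmap : (ray x).map g = ray (g x) := by
    have : ∀ i, g (next^[i] x) = next^[i] (g x) := by
      intro i
      induction i with
      | zero => rfl
      | succ i ih => rw [hiter, hiter, ← ih]; exact (hequiv ⟨g, hg⟩ _).symm
    simp only [Ray.map, ray, this]
  change Quot.mk _ ((ray x).map g) = _
  rw [hmap]
  exact Quot.sound (heq _ _)

/-- Non-trivial normal subgroups act without proper invariant subtrees. -/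
theorem IsGeodesicallyConvex.eq_univ_of_normal (hT : T.IsTree)
    (hsub : T.NoProperInvariantSubtree G) (hend : T.FixesNoEnd G) {N : Subgroup G}
    (hN : N.Normal) (hbot : N ≠ ⊥) {X : Set V} (hX : T.IsGeodesicallyConvex X)
    (hne : X.Nonempty) (hinv : ∀ n ∈ N, ∀ x ∈ X, n • x ∈ X) : X = Set.univ := by
  let F : Set (Set V) := {Y | T.IsGeodesicallyConvex Y ∧ Y.Nonempty ∧ ∀ n ∈ N, ∀ x ∈ Y, n • x ∈ Y}
  have hF : ∀ g : G, ∀ Y ∈ F, {x | g • x ∈ Y} ∈ F := by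
    rintro g Y ⟨hY, ⟨y, hy⟩, hYi⟩
    refine ⟨hY.smul_preimage hT.connected g, ⟨g⁻¹ • y, by simpa using hy⟩, fun n hn x hx => ?_⟩
    have := hYi _ (hN.conj_mem n hn g) _ hx
    rwa [mul_smul, mul_smul, inv_smul_smul] at this
  have hcore := hT.sInter_nonempty hend (F := F) (fun Y hY => hY.1) (fun Y hY => hY.2.1)
    (fun Y hY Z hZ => ⟨hY.1.inter hZ.1,
      hY.1.inter_nonempty hT (hT.exists_smul_ne hsub hN hbot) hZ.1 hY.2.1 hZ.2.1 hY.2.2 hZ.2.2,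
      fun n hn x hx => ⟨hY.2.2 n hn x hx.1, hZ.2.2 n hn x hx.2⟩⟩) hF
  have huniv := (IsGeodesicallyConvex.sInter fun Y (hY : Y ∈ F) => hY.1).eq_univ hT hsub hcore
    (fun g x hx Y hY => hx _ (hF g Y hY))
  exact Set.eq_univ_of_univ_subset (huniv ▸ Set.sInter_subset_of_mem ⟨hX, hne, hinv⟩)

/-! ### Elements that skewer an edge -/

theorem IsTree.smul_edgeSide (hT : T.IsTree) (g : G) {u v : V} (huv : T.Adj u v) :
    g • T.edgeSide u v = T.edgeSide (g • u) (g • v) := by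
  ext x
  rw [Set.mem_smul_set_iff_inv_smul_mem, ← hT.smul_mem_edgeSide_iff g huv, smul_inv_smul]

theorem IsTree.eq_and_eq_of_mem_edgeSide (hT : T.IsTree) {u v x y : V} (huv : T.Adj u v)
    (hxy : T.Adj x y) (hu : u ∈ T.edgeSide x y) (hv : v ∈ T.edgeSide y x) : u = x ∧ v = y := by
  have h := hT.dist_of_mem_edgeSide hxy hu hv
  rw [dist_eq_one_iff_adj.2 huv] at h
  exact ⟨hT.connected.dist_eq_zero_iff.1 (by omega),
    (hT.connected.dist_eq_zero_iff.1 (by omega : T.dist y v = 0)).symm⟩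

theorem IsTree.eq_and_eq_of_edgeSide_eq (hT : T.IsTree) {u v x y : V} (huv : T.Adj u v)
    (hxy : T.Adj x y) (h : T.edgeSide u v = T.edgeSide x y) : u = x ∧ v = y := by
  refine hT.eq_and_eq_of_mem_edgeSide huv hxy (h ▸ T.left_mem_edgeSide u v) ?_
  rw [← hT.compl_edgeSide hxy, ← h]
  exact hT.right_notMem_edgeSide huv

/-- The side of `u` misses `a • u`, so it lies within one side of the translated edge; the two cases
come from taking complements. -/
theorem IsTree.smul_edgeSide_of_smul_mem (hT : T.IsTree) {u v : V} (huv : T.Adj u v) {a : G}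
    (ha : a • u ∈ T.edgeSide v u) :
    a • T.edgeSide v u ⊂ T.edgeSide v u ∨ a • T.edgeSide u v ⊆ T.edgeSide v u := by
  have hauv : T.Adj (a • u) (a • v) := (adj_smul_iff a).2 huv
  rw [hT.smul_edgeSide a huv, hT.smul_edgeSide a huv.symm]
  have hau : a • u ∉ T.edgeSide u v := (hT.notMem_edgeSide_iff huv).2 ha
  have hS := hT.isGeodesicallyConvex_edgeSide huv
  have hmem := T.left_mem_edgeSide u v
  by_cases hu : u ∈ T.edgeSide (a • u) (a • v)
  · left
    have h1 := hS.subset_edgeSide hT hauv (Or.inr hau) hmem hu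
    rw [← Set.compl_subset_compl, hT.compl_edgeSide huv, hT.compl_edgeSide hauv] at h1
    exact (Set.ssubset_iff_of_subset h1).2 ⟨_, ha, hT.right_notMem_edgeSide hauv.symm⟩
  · right
    rw [hT.notMem_edgeSide_iff hauv] at hu
    have h1 := hS.subset_edgeSide hT hauv.symm (Or.inl hau) hmem hu
    rwa [← Set.compl_subset_compl, hT.compl_edgeSide huv, hT.compl_edgeSide hauv.symm] at h1

theorem IsTree.inv_smul_edgeSide_ssubset (hT : T.IsTree) {u v : V} (huv : T.Adj u v) {a : G}
    (ha : a • T.edgeSide u v ⊂ T.edgeSide u v) :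
    a⁻¹ • T.edgeSide v u ⊂ T.edgeSide v u := by
  rw [← hT.compl_edgeSide huv, Set.smul_set_compl, ssubset_iff_subset_not_subset,
    Set.compl_subset_compl, Set.compl_subset_compl]
  refine ⟨Set.subset_smul_set_iff.2 (by simpa using ha.1), fun h => ha.2 ?_⟩
  rwa [Set.smul_set_subset_iff_subset_inv_smul_set, inv_inv] at h

/-- A group without proper invariant subtrees contains, for every edge, a translation along
an axis through that edge. -/
theorem IsTree.exists_smul_edgeSide_ssubset [Infinite V] (hT : T.IsTree) {N : Subgroup G}
    (hmin : ∀ X : Set V, T.IsGeodesicallyConvex X → X.Nonempty →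
      (∀ n ∈ N, ∀ x ∈ X, n • x ∈ X) → X = Set.univ)
    {u v : V} (huv : T.Adj u v) : ∃ h ∈ N, h • T.edgeSide v u ⊂ T.edgeSide v u := by
  by_contra! hno
  have hno' : ∀ h ∈ N, ¬ h • T.edgeSide u v ⊂ T.edgeSide u v := fun h hh hs =>
    hno _ (N.inv_mem hh) (hT.inv_smul_edgeSide_ssubset huv hs)
  -- Otherwise the vertices whose `N`-orbit stays on the side of `x` form a proper invariant
  -- subtree.
  have hex : ∀ {x y : V}, T.Adj x y → ∃ a ∈ N, a • x ∈ T.edgeSide y x := by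
    intro x y hxy
    by_contra! h
    have huniv := hmin {z | ∀ n ∈ N, n • z ∈ T.edgeSide x y} (by
        intro a ha b hb c hc n hn
        exact (hT.isGeodesicallyConvex_edgeSide hxy).smul_preimage hT.connected n
          (ha n hn) (hb n hn) c hc)
      ⟨x, fun n hn => by
        rw [← hT.notMem_edgeSide_iff hxy.symm]
        exact h n hn⟩
      (fun n hn z hz m hm => by
        rw [← mul_smul]
        exact hz _ (N.mul_mem hm hn))
    have hy : y ∈ {z | ∀ n ∈ N, n • z ∈ T.edgeSide x y} := huniv ▸ Set.mem_univ y
    have := hy 1 N.one_mem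
    rw [one_smul] at this
    exact hT.right_notMem_edgeSide hxy this
  -- With no translations available, `a` and `b` swap the sides up to inclusion. As `b * a` cannot
  -- shrink a side properly, all inclusions are equalities and both elements invert the edge.
  have hflip : ∀ a ∈ N, a • u ∈ T.edgeSide v u → ∀ b ∈ N, b • v ∈ T.edgeSide u v →
      (a • u = v ∧ a • v = u) ∧ b • v = u ∧ b • u = v := by
    intro a ha hau b hb hbv
    have h1 := (hT.smul_edgeSide_of_smul_mem huv hau).resolve_left (hno a ha)
    have h2 := (hT.smul_edgeSide_of_smul_mem huv.symm hbv).resolve_left (hno' b hb)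
    have h3 : b • a • T.edgeSide u v ⊆ b • T.edgeSide v u := Set.smul_set_mono h1
    have h4 : b • a • T.edgeSide u v = T.edgeSide u v := by
      refine (h3.trans h2).antisymm (not_not.1 fun hns => hno' (b * a) (N.mul_mem hb ha) ?_)
      rw [mul_smul]
      exact ⟨h3.trans h2, hns⟩
    have h5 : b • T.edgeSide v u = T.edgeSide u v := h2.antisymm (h4.symm.subset.trans h3)
    have h6 : a • T.edgeSide u v = T.edgeSide v u := by
      have := h4.trans h5.symm
      exact smul_left_cancel b this
    rw [hT.smul_edgeSide _ huv] at h6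
    rw [hT.smul_edgeSide _ huv.symm] at h5
    exact ⟨hT.eq_and_eq_of_edgeSide_eq ((adj_smul_iff a).2 huv) huv.symm h6,
      hT.eq_and_eq_of_edgeSide_eq ((adj_smul_iff b).2 huv.symm) huv h5⟩
  obtain ⟨a, ha, hau⟩ := hex huv
  obtain ⟨b, hb, hbv⟩ := hex huv.symm
  have hab := hflip a ha hau b hb hbv
  -- If `n` keeps `u` on its side, then `n * b` carries `v` across, hence inverts the edge, so `n`
  -- fixes `u`; similarly for `v` with `n * a`.
  have huniv := hmin {u, v} (hT.connected.isGeodesicallyConvex_pair huv) ⟨u, Or.inl rfl⟩ (by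
    rintro n hn x (rfl | rfl)
    · by_cases hnx : n • x ∈ T.edgeSide v x
      · exact Or.inr (hflip n hn hnx b hb hbv).1.1
      · rw [hT.notMem_edgeSide_iff huv.symm, ← hab.2.1, ← mul_smul] at hnx
        rw [← hab.2.1, ← mul_smul, hab.2.1]
        rw [hab.2.1] at hnx
        exact Or.inl (hflip a ha hau _ (N.mul_mem hn hb) hnx).2.1
    · by_cases hnx : n • x ∈ T.edgeSide u x
      · exact Or.inl (hflip a ha hau n hn hnx).2.1
      · rw [hT.notMem_edgeSide_iff huv, ← hab.1.1, ← mul_smul] at hnx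
        rw [← hab.1.1, ← mul_smul, hab.1.1]
        rw [hab.1.1] at hnx
        exact Or.inr (hflip _ (N.mul_mem hn ha) hnx b hb hbv).1.1)
  exact Set.infinite_univ (huniv ▸ Set.toFinite {u, v})

/-- While `h • x` stays on the side of `u`, its geodesic to `h • v` passes through `v`, so each
application of `h` brings the point closer to `v` by `T.dist v (h • v)`. -/
theorem IsTree.exists_pow_smul_mem (hT : T.IsTree) {u v : V} (huv : T.Adj u v) {h : G}
    (hh : h • T.edgeSide v u ⊂ T.edgeSide v u) (x : V) :
    ∃ n : ℕ, h ^ n • x ∈ T.edgeSide v u := by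
  have hhuv : T.Adj (h • u) (h • v) := (adj_smul_iff h).2 huv
  have hsub := hh.1
  rw [hT.smul_edgeSide h huv.symm] at hsub
  have hhv : h • v ∈ T.edgeSide v u := hsub (T.left_mem_edgeSide _ _)
  have hpos : 0 < T.dist v (h • v) := by
    refine hT.connected.pos_dist_of_ne fun hv => ?_
    rw [← hv] at hsub hhuv
    -- If `h` fixed `v`, then `u`, a neighbour of `v` other than `h • u`, would lie in `h •
    -- T.edgeSide v u`, hence on the side of `v`.
    have hne : u ≠ h • u := fun hu => hh.ne (by rw [hT.smul_edgeSide h huv.symm, ← hv, ← hu])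
    refine hT.right_notMem_edgeSide huv.symm (hsub ?_)
    have h0 := hT.connected.pos_dist_of_ne hne
    rw [hT.mem_edgeSide_iff hhuv.symm]
    have h1 := dist_eq_one_iff_adj.2 huv
    rcases hT.dist_eq_dist_add_one_of_adj u hhuv with e | e <;> omega
  obtain ⟨k, hk⟩ : ∃ k, T.dist x v = k := ⟨_, rfl⟩
  induction k using Nat.strong_induction_on generalizing x with
  | _ k ih =>
    by_cases hx : h • x ∈ T.edgeSide v u
    · exact ⟨1, by simpa using hx⟩
    · rw [hT.notMem_edgeSide_iff huv.symm] at hx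
      have h1 := hT.dist_of_mem_edgeSide huv hx hhv
      have h2 := (hT.mem_edgeSide_iff huv _).1 hx
      rw [hT.connected.dist_smul] at h1
      obtain ⟨n, hn⟩ := ih (T.dist (h • x) v) (by omega) (h • x) rfl
      exact ⟨n + 1, by rwa [pow_succ, mul_smul]⟩

theorem IsTree.exists_smul_mem_of_finite (hT : T.IsTree) {N : Subgroup G} {u v : V}
    (huv : T.Adj u v) {h : G} (hN : h ∈ N) (hh : h • T.edgeSide v u ⊂ T.edgeSide v u)
    {F : Set V} (hF : F.Finite) : ∃ n ∈ N, ∀ x ∈ F, n • x ∈ T.edgeSide v u := by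
  have hev : ∀ x ∈ F, ∀ᶠ n : ℕ in Filter.atTop, h ^ n • x ∈ T.edgeSide v u := by
    intro x _
    obtain ⟨n, hn⟩ := hT.exists_pow_smul_mem huv hh x
    refine Filter.eventually_atTop.2 ⟨n, fun m hm => ?_⟩
    induction m, hm using Nat.le_induction with
    | base => exact hn
    | succ m _ ih =>
      rw [pow_succ', mul_smul]
      exact hh.1 (Set.smul_mem_smul_set ih)
  obtain ⟨n, hn⟩ := ((Filter.eventually_all_finite hF).2 hev).exists
  exact ⟨h ^ n, N.pow_mem hN n, hn⟩

theorem infinite_of_smul_ssubset {S : Set V} {h : G} (hh : h • S ⊂ S) : S.Infinite := by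
  intro hfin
  have h1 := Set.ncard_lt_ncard hh hfin
  rw [← Set.image_smul, Set.ncard_image_of_injective _ (MulAction.injective h)] at h1
  omega

/-! ### Pointwise stabilizers of half-trees -/

/-- Each side properly contains a translate of itself, so it is infinite. -/
theorem IsTree.isHalfTree_edgeSide [Infinite V] (hT : T.IsTree)
    (hsub : T.NoProperInvariantSubtree G) {u v : V} (huv : T.Adj u v) :
    T.IsHalfTree (T.edgeSide u v) := by
  have key : ∀ {x y : V}, T.Adj x y → (T.edgeSide y x).Infinite := by
    intro x y hxy
    obtain ⟨h, -, hh⟩ := hT.exists_smul_edgeSide_ssubset (N := (⊤ : Subgroup G))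
      (fun X hX hne hinv => hX.eq_univ hT hsub hne fun g => hinv g trivial) hxy
    exact infinite_of_smul_ssubset hh
  exact ⟨u, v, huv, key huv.symm, key huv, rfl⟩

theorem IsHalfTree.smul (hT : T.IsTree) {S : Set V} (hS : T.IsHalfTree S) (g : G) :
    T.IsHalfTree (g • S) := by
  obtain ⟨u, v, huv, hu, hv, rfl⟩ := hS
  refine ⟨g • u, g • v, (adj_smul_iff g).2 huv, ?_, ?_, hT.smul_edgeSide g huv⟩
  · rw [← hT.smul_edgeSide g huv]
    exact hu.image (MulAction.injective g).injOn
  · rw [← hT.smul_edgeSide g huv.symm]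
    exact hv.image (MulAction.injective g).injOn

theorem IsTree.normal_plusPlus (hT : T.IsTree) (G : Subgroup (T ≃g T)) :
    (T.plusPlus G).Normal := by
  have : (⨆ (S : Set V) (_ : T.IsHalfTree S), fixingSubgroup G S).Normal := by
    refine ⟨fun n hn g => ?_⟩
    suffices h : (⨆ (S : Set V) (_ : T.IsHalfTree S), fixingSubgroup G S) ≤
        (⨆ (S : Set V) (_ : T.IsHalfTree S), fixingSubgroup G S).comap
          (MulAut.conj g).toMonoidHom from h hn
    refine iSup₂_le fun S hS f hf => ?_
    refine Subgroup.mem_iSup_of_mem (g • S) (Subgroup.mem_iSup_of_mem (hS.smul hT g) ?_)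
    rw [mem_fixingSubgroup_iff] at hf ⊢
    rintro _ ⟨y, hy, rfl⟩
    simp [mul_smul, hf y hy]
  exact Subgroup.is_normal_topologicalClosure _

theorem fixingSubgroup_le_plusPlus {S : Set V} (hS : T.IsHalfTree S) :
    fixingSubgroup G S ≤ T.plusPlus G :=
  (le_iSup₂ (f := fun S (_ : T.IsHalfTree S) => fixingSubgroup G S) S hS).trans
    (Subgroup.le_topologicalClosure _)

/-- A closed normal subgroup that can move every finite set of vertices into `S` contains the
pointwise stabilizer of `S`. -/
theorem fixingSubgroup_le_of_forall_finite {N : Subgroup G} (hN : N.Normal)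
    (hclosed : IsClosed (N : Set G)) {S : Set V}
    (hS : ∀ F : Set V, F.Finite → ∃ n ∈ N, ∀ x ∈ F, n • x ∈ S) : fixingSubgroup G S ≤ N := by
  intro f hf
  rw [mem_fixingSubgroup_iff] at hf
  have hbasis := (aut_hasBasis_nhds T (f : T ≃g T)).comap (Subtype.val : G → T ≃g T)
  rw [← nhds_subtype] at hbasis
  rw [← SetLike.mem_coe, ← hclosed.closure_eq, mem_closure_iff_nhds_basis hbasis]
  intro F hF
  obtain ⟨n, hn, hnF⟩ := hS F hF
  -- This commutator is a conjugate of `n⁻¹` times `n`. On `F` the factor `f⁻¹` acts trivially,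
  -- because `n • x ∈ S`, and only `f` remains.
  refine ⟨f * n⁻¹ * f⁻¹ * n, N.mul_mem (hN.conj_mem _ (N.inv_mem hn) f) hn, fun x hx => ?_⟩
  have hfx : f⁻¹ • n • x = n • x := inv_smul_eq_iff.2 (hf _ (hnF x hx)).symm
  change (f * n⁻¹ * f⁻¹ * n) • x = f • x
  rw [mul_smul, mul_smul, hfx, mul_smul, inv_smul_smul]

theorem IsTree.plusPlus_le [Infinite V] (hT : T.IsTree) (hsub : T.NoProperInvariantSubtree G)
    (hend : T.FixesNoEnd G) {N : Subgroup G} (hN : IsNontrivialClosedNormal N) :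
    T.plusPlus G ≤ N := by
  refine Subgroup.topologicalClosure_minimal _ (iSup₂_le ?_) hN.2.1
  rintro _ ⟨u, v, huv, -, -, rfl⟩
  refine fixingSubgroup_le_of_forall_finite hN.2.2 hN.2.1 fun F hF => ?_
  obtain ⟨h, hh, hs⟩ := hT.exists_smul_edgeSide_ssubset (N := N) (fun X hX hne hinv =>
    hX.eq_univ_of_normal hT hsub hend hN.2.2 hN.1 hne hinv) huv.symm
  exact hT.exists_smul_mem_of_finite huv.symm hh hs hF

theorem IsTree.isNontrivialClosedNormal_plusPlus [Infinite V] (hT : T.IsTree)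
    (hsub : T.NoProperInvariantSubtree G) (hH : T.PropertyH G) :
    IsNontrivialClosedNormal (T.plusPlus G) := by
  refine ⟨fun hbot => ?_, Subgroup.isClosed_topologicalClosure _, hT.normal_plusPlus G⟩
  obtain ⟨a, b, hab⟩ := exists_pair_ne V
  obtain ⟨c, hc, -⟩ := hT.connected.exists_adj_dist hab
  have hS := hT.isHalfTree_edgeSide hsub hc
  exact hH _ hS (le_bot_iff.1 (hbot ▸ fixingSubgroup_le_plusPlus hS))

end SimpleGraph

theorem corollary7 {V : Type*} [Infinite V] (T : SimpleGraph V) (hT : T.IsTree)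
    (G : Subgroup (T ≃g T)) (hclosed : IsClosed (G : Set (T ≃g T)))
    (hH : T.PropertyH G) (hsub : T.NoProperInvariantSubtree G) (hend : T.FixesNoEnd G) :
    Minimal SimpleGraph.IsNontrivialClosedNormal (T.plusPlus G) ∧
      (∀ N : Subgroup G, Minimal SimpleGraph.IsNontrivialClosedNormal N → N = T.plusPlus G) ∧
      (∀ N : Subgroup G, SimpleGraph.IsNontrivialClosedNormal N → T.plusPlus G ≤ N) := by
  have hpp := hT.isNontrivialClosedNormal_plusPlus hsub hH
  have hle : ∀ N : Subgroup G, SimpleGraph.IsNontrivialClosedNormal N → T.plusPlus G ≤ N :=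
    fun N hN => hT.plusPlus_le hsub hend hN
  exact ⟨⟨hpp, fun N hN _ => hle N hN⟩, fun N hN => (hN.2 hpp (hle N hN.1)).antisymm (hle N hN.1),
    hle⟩
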